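/- Throughout, polyhedra are considered combinatorially. A \emph{standard polyhedron} is a finite 2-dimensional cell complex $P$, i.e. a finite graph $S(P)$ (loops and multiple edges allowed) with finitely many polygonal discs, the \emph{faces}, attached along closed edge-paths, such that the link of every vertex is the 1-skeleton of the tetrahedron (so each vertex has a neighbourhood which is a cone over this graph, and exactly three sheets of $P$ meet along each edge). The graph $S(P)$, which is 4-valent, is the \emph{singular set} of $P$. An \emph{orientation} of $P$ is a screw-orientation along each edge (a cyclic order of the three sheets for each direction of travel along the edge, the two directions giving opposite cyclic orders) such that at each vertex the cyclic orders around the four outgoing half-edges are induced by a single orientation of a ball containing the cone over the 1-skeleton of the tetrahedron in the standard way. Two oriented standard polyhedra are considered the same if there is a bijection between their cells (respecting incidences, attaching paths of the faces included) that preserves the orientations, and \emph{distinct} otherwise. The \emph{open chain} with $n$ vertices is the graph with vertices $v_1,\dots,v_n$, one closed edge (loop) at $v_1$, one closed edge at $v_n$, and two edges joining $v_i$ to $v_{i+1}$ for each $i=1,\dots,n-1$. For every integer $n\geqslant 2$ there are at least $4\cdot 12^{(2n-5)/3}$ pairwise distinct oriented standard polyhedra with exactly one face whose singular set is isomorphic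 to the open chain with $n$ vertices. -/

import Mathlib

/-- A finite graph (loops and multiple edges allowed), given by its vertices and its
half-edges: every half-edge issues from a vertex, and the edges are the pairs
`{h, opp h}` of opposite half-edges. -/
structure HalfEdgeGraph where
  V : Type
  H : Type
  finite_V : Finite V
  finite_H : Finite H
  origin : H → V
  opp : H → H
  opp_opp : ∀ h, opp (opp h) = h
  opp_ne : ∀ h, opp h ≠ h

/-- Isomorphism of graphs. -/
def HalfEdgeGraph.Isomorphic (G G' : HalfEdgeGraph) : Prop :=
  ∃ (f : G.V ≃ G'.V) (g : G.H ≃ G'.H),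
    (∀ h, G'.origin (g h) = f (G.origin h)) ∧ (∀ h, G'.opp (g h) = g (G.opp h))

/-- The opposite of a half-edge of the open chain with `n` vertices. The half-edges at the
`i`-th vertex are `(i, s, b)`, where `s = false` are the two on the left, `s = true` the two on
the right. Right half-edges at `i` are joined to left half-edges at `i + 1`; at the two ends of
the chain the two free half-edges are joined to each other. -/
def openChainOpp (n : ℕ) : Fin n × Bool × Bool → Fin n × Bool × Bool
  | (i, true, b) =>
      if h : i.val + 1 < n then (⟨i.val + 1, h⟩, false, b) else (i, true, !b)
  | (i, false, b) =>
      if 0 < i.val then (⟨i.val - 1, by omega⟩, true, b) else (i, false, !b)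

theorem openChainOpp_opp (n : ℕ) (h : Fin n × Bool × Bool) :
    openChainOpp n (openChainOpp n h) = h := by
  obtain ⟨⟨i, hi⟩, s, b⟩ := h
  cases s
  · by_cases h0 : 0 < i
    · have h1 : i - 1 + 1 = i := by omega
      simp [openChainOpp, h0, h1, hi]
    · simp [openChainOpp, h0]
  · by_cases h0 : i + 1 < n
    · simp [openChainOpp, h0]
    · simp [openChainOpp, h0]

theorem openChainOpp_ne (n : ℕ) (h : Fin n × Bool × Bool) : openChainOpp n h ≠ h := by
  obtain ⟨⟨i, hi⟩, s, b⟩ := h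
  cases s
  · by_cases h0 : 0 < i <;> simp [openChainOpp, h0]
  · by_cases h0 : i + 1 < n <;> simp [openChainOpp, h0]

/-- The open chain with `n` vertices: two edges join the `i`-th vertex to the `(i+1)`-st one,
and there is a closed edge at the first vertex and one at the last vertex. -/
def openChain (n : ℕ) : HalfEdgeGraph where
  V := Fin n
  H := Fin n × Bool × Bool
  finite_V := inferInstance
  finite_H := inferInstance
  origin := fun h => h.1
  opp := openChainOpp n
  opp_opp := openChainOpp_opp n
  opp_ne := openChainOpp_ne n

/-- A finite two-dimensional cell complex: a finite graph (the 1-skeleton) with finitely many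
polygonal discs attached to it along closed edge-paths.

A flag is a corner of one of the polygons together with one of the two sides of the polygon
that meet at this corner. It is attached to a half-edge (a germ of edge) of the 1-skeleton,
`strand x`. `swap x` is the other flag at the same corner, and `slide x` is the flag at the other
end of the same side. The polygons are the cycles obtained by alternating `swap` and `slide`. -/
structure PolygonalComplex extends HalfEdgeGraph where
  Flag : Type
  finite_Flag : Finite Flag
  strand : Flag → H
  swap : Flag → Flag
  slide : Flag → Flag
  swap_swap : ∀ x, swap (swap x) = x
  swap_ne : ∀ x, swap x ≠ x
  slide_slide : ∀ x, slide (slide x) = x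
  origin_strand_swap : ∀ x, origin (strand (swap x)) = origin (strand x)
  strand_slide : ∀ x, strand (slide x) = opp (strand x)

/-- The faces (open 2-cells): two flags belong to the same polygon if and only if they are
related by a sequence of moves `swap` and `slide`. -/
def PolygonalComplex.Face (Q : PolygonalComplex) : Type :=
  Quot (fun x y : Q.Flag => y = Q.swap x ∨ y = Q.slide x)

/-- The complex is a standard polyhedron, with its canonical cell structure, in which the
vertices, edges and 2-cells are respectively the points of `V`, the components of `S \ V` and the
components of the complement of `S` (`S` being the singular set). This says that the link of each
vertex, the graph whose nodes are the half-edges at the vertex and whose edges are the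
corners of polygons there, is the complete graph on four nodes, that is the 1-skeleton of the
tetrahedron: a neighbourhood of a vertex is the cone over it. In particular each half-edge
carries exactly three flags, so that three sheets meet along each edge. -/
structure PolygonalComplex.IsStandard (Q : PolygonalComplex) : Prop where
  four_strands : ∀ v : Q.V, Nat.card {h : Q.H // Q.origin h = v} = 4
  no_loop_in_link : ∀ x : Q.Flag, Q.strand (Q.swap x) ≠ Q.strand x
  complete_link : ∀ h h' : Q.H, Q.origin h = Q.origin h' → h ≠ h' →
    ∃! x : Q.Flag, Q.strand x = h ∧ Q.strand (Q.swap x) = h'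

/-- A screw-orientation along the edges of a (standard) polyhedron, compatible at the vertices.

`rot` gives, for each half-edge `h`, a cyclic order of the three sheets around `h`, namely
the counterclockwise order for an observer who travels along `h` away from its vertex.
* `rot_slide_rot`: seen from the other end of the edge (that is, travelling in the opposite
  direction) the cyclic order is the reversed one, so each edge carries a well-defined screw.
* `rot_swap_cube`: at each vertex the four cyclic orders are induced by one orientation of a ball
  containing the cone over the 1-skeleton of the tetrahedron. That is, the link, with the cyclic
  order of the three edges at each node, is embedded in an oriented sphere as the 1-skeleton
  of a tetrahedron; equivalently, its complementary regions, which are the cycles of `rot ∘ swap`,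
  are triangles. -/
structure PolygonalComplex.Orientation (Q : PolygonalComplex) where
  rot : Q.Flag → Q.Flag
  strand_rot : ∀ x, Q.strand (rot x) = Q.strand x
  rot_ne : ∀ x, rot x ≠ x
  rot_cube : ∀ x, rot (rot (rot x)) = x
  rot_slide_rot : ∀ x, rot (Q.slide (rot x)) = Q.slide x
  rot_swap_cube : ∀ x, rot (Q.swap (rot (Q.swap (rot (Q.swap x))))) = x

/-- An oriented standard polyhedron. -/
structure OrientedStandardPolyhedron where
  complex : PolygonalComplex
  standard : complex.IsStandard
  orientation : complex.Orientation

namespace OrientedStandardPolyhedron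

/-- The singular set of a standard polyhedron, a 4-valent graph: the union of the vertices
and of the edges, along all of which three sheets meet. -/
def singularGraph (P : OrientedStandardPolyhedron) : HalfEdgeGraph :=
  P.complex.toHalfEdgeGraph

/-- The number of faces, i.e. of components of the complement of the singular set. -/
noncomputable def numFaces (P : OrientedStandardPolyhedron) : ℕ :=
  Nat.card P.complex.Face

/-- Two oriented standard polyhedra are the same if there is an isomorphism between them (a
bijection between the cells that respects all incidences) that preserves the orientation. -/
def Isomorphic (P P' : OrientedStandardPolyhedron) : Prop :=
  ∃ (f : P.complex.V ≃ P'.complex.V) (g : P.complex.H ≃ P'.complex.H)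
    (k : P.complex.Flag ≃ P'.complex.Flag),
    (∀ h, P'.complex.origin (g h) = f (P.complex.origin h)) ∧
    (∀ h, P'.complex.opp (g h) = g (P.complex.opp h)) ∧
    (∀ x, P'.complex.strand (k x) = g (P.complex.strand x)) ∧
    (∀ x, P'.complex.swap (k x) = k (P.complex.swap x)) ∧
    (∀ x, P'.complex.slide (k x) = k (P.complex.slide x)) ∧
    (∀ x, P'.orientation.rot (k x) = k (P.orientation.rot x))

end OrientedStandardPolyhedron

/-! ### The link of a vertex -/

/-! Polyhedra are built by choosing one element of `ZMod 3` per edge, the offset with which the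
three sheets at its two ends are glued. Cut after a vertex, the chain leaves six loose sheets, and
the part on the left matters only through how it pairs them, provided no face has closed up. Three
pairings (states) are used. At each vertex, finite checks count the offsets of the next two edges
that lead from one state to another: any cycle s → s+1 → s+2 → s admits 144 = 12² choices, which
gives the growth 12^(2/3) per vertex. With the closed edges and the last pair, `exists_states` and
`prod_card_wordParams` give at least 24 · (2/3) · 12^((2n-5)/3) choices of offsets;
`flag_invariant_const` shows that each produces a single face.

An isomorphism preserves the cyclic orders, so at a vertex it is a translation of the link followed
by a shift of the labels. The closed edge at an end forces the shift to vanish there, and hence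
along the whole chain (`chainSetoid_of_isomorphic`). What remains is a symmetry of the chain
determined by the image of one loop half-edge, so at most four choices share an isomorphism class,
and 24 · (2/3) / 4 = 4. -/

/-- The reversal of a corner in the link of a vertex. The four half-edges at the vertex are
identified with the field with four elements, and the corner `(h, j)` joins `h` to `h + ω ^ j`. -/
def linkSwap (z : Bool × Bool × ZMod 3) : Bool × Bool × ZMod 3 :=
  (xor z.1 (decide (z.2.2 ≠ 0)), xor z.2.1 (decide (z.2.2 ≠ 1)), z.2.2)

theorem linkSwap_ne (z : Bool × Bool × ZMod 3) :
    ((linkSwap z).1, (linkSwap z).2.1) ≠ (z.1, z.2.1) := by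
  revert z; decide

theorem existsUnique_linkSwap (a b : Bool × Bool) (h : a ≠ b) :
    ∃! j : ZMod 3, ((linkSwap (a.1, a.2, j)).1, (linkSwap (a.1, a.2, j)).2.1) = b := by
  revert a b; simp only [ExistsUnique]; decide

/-- The effect of `linkSwap` followed by a rotation. -/
def linkTurn (z : Bool × Bool × ZMod 3) : Bool × Bool × ZMod 3 :=
  ((linkSwap z).1, (linkSwap z).2.1, (linkSwap z).2.2 + 1)

/-- Three turns use each label once, and 1 + ω + ω² = 0 in the field with four elements. -/
theorem linkTurn_cube (z : Bool × Bool × ZMod 3) : linkTurn (linkTurn (linkTurn z)) = z := by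
  revert z; decide

/-! ### Polyhedra along the open chain -/

/-- The complex obtained from the open chain by gluing, along each half-edge `h`, the sheets by
the order-reversing map `j ↦ c h - j`. -/
def chainComplex (n : ℕ) (c : Fin n × Bool × Bool → ZMod 3)
    (hc : ∀ h, c (openChainOpp n h) = c h) : PolygonalComplex where
  toHalfEdgeGraph := openChain n
  Flag := (Fin n × Bool × Bool) × ZMod 3
  finite_Flag := inferInstance
  strand := Prod.fst
  swap := fun x =>
    ((x.1.1, (linkSwap (x.1.2.1, x.1.2.2, x.2)).1, (linkSwap (x.1.2.1, x.1.2.2, x.2)).2.1), x.2)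
  slide := fun x => (openChainOpp n x.1, c x.1 - x.2)
  swap_swap := by
    rintro ⟨⟨i, s, b⟩, j⟩
    simp [linkSwap]
  swap_ne := by
    rintro ⟨⟨i, s, b⟩, j⟩ h
    have h1 := linkSwap_ne (s, b, j)
    simp only [Prod.mk.injEq] at h
    exact h1 (by simp [h.1.2.1, h.1.2.2])
  slide_slide := by
    rintro ⟨h, j⟩
    simp [hc, openChainOpp_opp]
  origin_strand_swap := fun _ => rfl
  strand_slide := fun _ => rfl

theorem chainComplex_isStandard (n : ℕ) (c : Fin n × Bool × Bool → ZMod 3)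
    (hc : ∀ h, c (openChainOpp n h) = c h) : (chainComplex n c hc).IsStandard where
  four_strands := by
    intro v
    let e : {h : Fin n × Bool × Bool // h.1 = v} ≃ Bool × Bool :=
      { toFun := fun h => h.1.2
        invFun := fun p => ⟨(v, p), rfl⟩
        left_inv := by rintro ⟨⟨i, p⟩, rfl⟩; rfl
        right_inv := fun _ => rfl }
    exact (Nat.card_congr e).trans (by simp)
  no_loop_in_link := by
    rintro ⟨⟨i, s, b⟩, j⟩ h
    have h1 := linkSwap_ne (s, b, j)
    have h2 := congrArg (fun p : Fin n × Bool × Bool => p.2) h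
    exact h1 h2
  complete_link := by
    rintro ⟨i, a⟩ ⟨i', a'⟩ h0 hne
    obtain rfl : i = i' := h0
    have ha : a ≠ a' := fun h => hne (by rw [h])
    obtain ⟨j, hj, huniq⟩ := existsUnique_linkSwap a a' ha
    refine ⟨((i, a), j), ⟨rfl, congrArg (Prod.mk i) hj⟩, ?_⟩
    rintro ⟨h, k⟩ ⟨hk1, hk2⟩
    obtain rfl : h = (i, a) := hk1
    have : k = j := huniq k (congrArg Prod.snd hk2)
    rw [this]

/-- The screw-orientation of `chainComplex`. -/
def chainOrientation (n : ℕ) (c : Fin n × Bool × Bool → ZMod 3)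
    (hc : ∀ h, c (openChainOpp n h) = c h) : (chainComplex n c hc).Orientation where
  rot := fun x => (x.1, x.2 + 1)
  strand_rot := fun _ => rfl
  rot_ne := by
    rintro ⟨h, j⟩ e
    have := congrArg Prod.snd e
    simp at this
  rot_cube := by
    rintro ⟨h, j⟩
    have : j + 1 + 1 + 1 = j := by revert j; decide
    exact congrArg (Prod.mk h) this
  rot_slide_rot := by
    rintro ⟨h, j⟩
    have : c h - (j + 1) + 1 = c h - j := by ring
    exact congrArg (Prod.mk _) this
  rot_swap_cube := by
    rintro ⟨⟨i, s, b⟩, j⟩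
    have := linkTurn_cube (s, b, j)
    exact congrArg (fun z : Bool × Bool × ZMod 3 => (((i, z.1, z.2.1), z.2.2) :
      (Fin n × Bool × Bool) × ZMod 3)) this

/-- The oriented standard polyhedron with gluing parameters `c` along the open chain. -/
def chainPolyhedron (n : ℕ) (c : Fin n × Bool × Bool → ZMod 3)
    (hc : ∀ h, c (openChainOpp n h) = c h) : OrientedStandardPolyhedron where
  complex := chainComplex n c hc
  standard := chainComplex_isStandard n c hc
  orientation := chainOrientation n c hc

theorem chainPolyhedron_singularGraph (n : ℕ) (c : Fin n × Bool × Bool → ZMod 3)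
    (hc : ∀ h, c (openChainOpp n h) = c h) :
    (chainPolyhedron n c hc).singularGraph.Isomorphic (openChain n) :=
  ⟨Equiv.refl _, Equiv.refl _, fun _ => rfl, fun _ => rfl⟩

/-! ### Tracing faces through a vertex -/

/-- Follow a face from the corner `z` until it leaves on the right, where `L` describes the
connections on the left of the vertex. -/
def traceRight (L : Bool × ZMod 3 → Bool × ZMod 3) :
    ℕ → Bool × Bool × ZMod 3 → Bool × Bool × ZMod 3
  | 0, z => z
  | _ + 1, (true, x) => (true, x)
  | k + 1, (false, x) => traceRight L k (linkSwap (false, L x))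

theorem traceRight_invariant {α : Type*} (q : Bool × Bool × ZMod 3 → α)
    (L : Bool × ZMod 3 → Bool × ZMod 3) (hq : ∀ z, q (linkSwap z) = q z)
    (hL : ∀ x, q (false, L x) = q (false, x)) (k : ℕ) (z : Bool × Bool × ZMod 3) :
    q (traceRight L k z) = q z := by
  induction k generalizing z with
  | zero => rfl
  | succ k ih =>
    obtain ⟨s, x⟩ := z
    cases s
    · rw [traceRight, ih, hq, hL]
    · rfl

/-- The connections `L` on the left of a vertex induce the connections `M` on its right, and no
face closes up. -/
def Transfers (L M : Bool × ZMod 3 → Bool × ZMod 3) : Prop :=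
  -- Fuel 3 suffices: each passage on the left uses up two of the six flags there.
  (∀ x, traceRight L 3 (linkSwap (true, x)) = (true, M x)) ∧
    ∀ x, (traceRight L 3 (false, x)).1 = true

instance (L M : Bool × ZMod 3 → Bool × ZMod 3) : Decidable (Transfers L M) :=
  inferInstanceAs (Decidable (_ ∧ _))

theorem Transfers.apply_right {α : Type*} {q : Bool × Bool × ZMod 3 → α}
    {L M : Bool × ZMod 3 → Bool × ZMod 3} (h : Transfers L M) (hq : ∀ z, q (linkSwap z) = q z)
    (hL : ∀ x, q (false, L x) = q (false, x)) (x : Bool × ZMod 3) :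
    q (true, M x) = q (true, x) := by
  rw [← h.1, traceRight_invariant q L hq hL, hq]

/-- This is where the absence of closed faces enters: every flag at the vertex lies on a strand that
comes out on the right. -/
theorem Transfers.exists_right {α : Type*} {q : Bool × Bool × ZMod 3 → α}
    {L M : Bool × ZMod 3 → Bool × ZMod 3} (h : Transfers L M) (hq : ∀ z, q (linkSwap z) = q z)
    (hL : ∀ x, q (false, L x) = q (false, x)) (z : Bool × Bool × ZMod 3) :
    ∃ x, q z = q (true, x) := by
  obtain ⟨s, x⟩ := z
  cases s
  · refine ⟨(traceRight L 3 (false, x)).2, ?_⟩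
    rw [← h.2 x, Prod.mk.eta, traceRight_invariant q L hq hL]
  · exact ⟨x, rfl⟩

/-- One step along a face at a vertex with connections `L` on the left and `R` on the right. -/
def faceStep (L R : Bool × ZMod 3 → Bool × ZMod 3) (z : Bool × Bool × ZMod 3) :
    Bool × Bool × ZMod 3 :=
  linkSwap (z.1, if z.1 then R z.2 else L z.2)

/-- A vertex with connections `L` on the left and `R` on the right carries a single face. -/
def Closes (L R : Bool × ZMod 3 → Bool × ZMod 3) : Prop :=
  -- The vertex has six corners. A single face visits each once, and `linkSwap` supplies the flag
  -- for the other direction of travel.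
  ∀ z, ∃ k : Fin 6, (faceStep L R)^[k] (false, false, 0) = z ∨
    linkSwap ((faceStep L R)^[k] (false, false, 0)) = z

instance (L R : Bool × ZMod 3 → Bool × ZMod 3) : Decidable (Closes L R) :=
  inferInstanceAs (Decidable (∀ _, _))

theorem Closes.apply_eq {α : Type*} {q : Bool × Bool × ZMod 3 → α}
    {L R : Bool × ZMod 3 → Bool × ZMod 3} (h : Closes L R) (hq : ∀ z, q (linkSwap z) = q z)
    (hL : ∀ x, q (false, L x) = q (false, x)) (hR : ∀ x, q (true, R x) = q (true, x))
    (z : Bool × Bool × ZMod 3) : q z = q (false, false, 0) := by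
  have hs : ∀ z, q (faceStep L R z) = q z := by
    rintro ⟨s, x⟩
    cases s
    · exact (hq _).trans (hL x)
    · exact (hq _).trans (hR x)
  have hi : ∀ (k : ℕ) z, q ((faceStep L R)^[k] z) = q z := by
    intro k
    induction k with
    | zero => exact fun _ => rfl
    | succ k ih => intro z; rw [Function.iterate_succ_apply, ih, hs]
  obtain ⟨k, hk | hk⟩ := h z
  · rw [← hk, hi]
  · rw [← hk, hq, hi]

/-- The connections made by a closed edge with gluing parameter `l`. -/
def loopPairing (l : ZMod 3) (x : Bool × ZMod 3) : Bool × ZMod 3 := (!x.1, l - x.2)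

/-- The connections `M` seen across a pair of edges with gluing parameters `u`. -/
def acrossEdges (u : Bool → ZMod 3) (M : Bool × ZMod 3 → Bool × ZMod 3) (x : Bool × ZMod 3) :
    Bool × ZMod 3 :=
  ((M (x.1, u x.1 - x.2)).1, u (M (x.1, u x.1 - x.2)).1 - (M (x.1, u x.1 - x.2)).2)

/-- The three ways in which an initial segment of the chain connects the six sheets that
leave it. -/
def pairing (s : Fin 3) (x : Bool × ZMod 3) : Bool × ZMod 3 :=
  if s = 0 then (!x.1, x.2)
  else if s = 1 then (if x.2 = 0 then (!x.1, 0) else (x.1, -x.2))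
  else (!x.1, -x.2)

/-- The parameters of a closed edge at an end of the chain. -/
def loopParams : Finset (Bool → ZMod 3) := {fun _ => 1, fun _ => 2}

/-- The parameters of a pair of edges that lead from the state `s` to the state `s'`. -/
def transferParams (s s' : Fin 3) : Finset (Bool → ZMod 3) :=
  {u | Transfers (acrossEdges u (pairing s)) (pairing s')}

/-- The parameters of the last pair of edges that produce a single face from the state `s`. -/
def closingParams (s : Fin 3) : Finset (Bool → ZMod 3) :=
  {u | ∀ w ∈ loopParams, Closes (acrossEdges u (pairing s)) (loopPairing (w false))}

/-! ### Finite checks at one vertex: transitions between states and their numbers -/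

theorem card_loopParams : loopParams.card = 2 := by decide +kernel

/-- Both nonzero offsets give state 0. Offset 0 is not allowed: the corner between the two ends of
the closed edge would then close up into a face by itself. -/
theorem transfers_loop : ∀ w ∈ loopParams, Transfers (loopPairing (w false)) (pairing 0) := by
  decide +kernel

theorem card_transferParams_succ :
    ∀ s, (transferParams s (s + 1)).card * (transferParams (s + 1) (s + 2)).card *
      (transferParams (s + 2) s).card = 144 := by
  decide +kernel

theorem card_transferParams_zero_one : (transferParams 0 1).card = 6 := by decide +kernel

theorem card_transferParams_one_one : (transferParams 1 1).card = 2 := by decide +kernel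

theorem card_closingParams : ∀ s, s ≠ 2 → (closingParams s).card = 6 := by decide +kernel

/-! ### Polyhedra with one face -/

section Faces

variable {n : ℕ} {c : Fin n × Bool × Bool → ZMod 3}

theorem openChainOpp_right (i : Fin n) (b : Bool) (h : i.val + 1 < n) :
    openChainOpp n (i, true, b) = (⟨i.val + 1, h⟩, false, b) := by
  simp [openChainOpp, h]

theorem openChainOpp_first (i : Fin n) (b : Bool) (h : i.val = 0) :
    openChainOpp n (i, false, b) = (i, false, !b) := by
  simp [openChainOpp, h]

theorem openChainOpp_last (i : Fin n) (b : Bool) (h : i.val + 1 = n) :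
    openChainOpp n (i, true, b) = (i, true, !b) := by
  simp [openChainOpp, h]

/-- If the gluing parameters transfer the pairings along the chain and close up at its end, then
all the flags lie in one face. -/
theorem flag_invariant_const {α : Type*} (hn : 2 ≤ n)
    (hc : ∀ h, c (openChainOpp n h) = c h) (q : (Fin n × Bool × Bool) × ZMod 3 → α)
    (hswap : ∀ x, q ((chainComplex n c hc).swap x) = q x)
    (hslide : ∀ x, q ((chainComplex n c hc).slide x) = q x)
    (M : ℕ → Bool × ZMod 3 → Bool × ZMod 3)
    (hfirst : Transfers (loopPairing (c (⟨0, by omega⟩, false, false))) (M 0))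
    (hstep : ∀ i (h : i + 2 < n),
      Transfers (acrossEdges (fun b => c (⟨i, by omega⟩, true, b)) (M i)) (M (i + 1)))
    (hlast : Closes (acrossEdges (fun b => c (⟨n - 2, by omega⟩, true, b)) (M (n - 2)))
      (loopPairing (c (⟨n - 1, by omega⟩, true, false)))) (x y : (Fin n × Bool × Bool) × ZMod 3) :
    q x = q y := by
  let p : Fin n → Bool × Bool × ZMod 3 → α := fun i z => q ((i, z.1, z.2.1), z.2.2)
  have hp : ∀ i z, p i (linkSwap z) = p i z := fun i z => hswap ((i, z.1, z.2.1), z.2.2)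
  have hglue : ∀ (i : Fin n) (h : i.val + 1 < n) (b : Bool) (j : ZMod 3),
      p ⟨i + 1, h⟩ (false, b, c (i, true, b) - j) = p i (true, b, j) := by
    intro i h b j
    have h1 := hslide ((i, true, b), j)
    change q (openChainOpp n (i, true, b), c (i, true, b) - j) = _ at h1
    rw [openChainOpp_right i b h] at h1
    exact h1
  have hglue' : ∀ (i : Fin n) (h : i.val + 1 < n) (b : Bool) (j : ZMod 3),
      p ⟨i + 1, h⟩ (false, b, j) = p i (true, b, c (i, true, b) - j) := by
    intro i h b j
    rw [← hglue i h, sub_sub_cancel]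
  have hacross : ∀ (i : Fin n) (h : i.val + 1 < n) (N : Bool × ZMod 3 → Bool × ZMod 3),
      (∀ x, p i (true, N x) = p i (true, x)) → ∀ x,
      p ⟨i + 1, h⟩ (false, acrossEdges (fun b => c (i, true, b)) N x) =
        p ⟨i + 1, h⟩ (false, x) := by
    intro i h N hN x
    rw [acrossEdges, hglue, Prod.mk.eta, hN, ← hglue' i h]
  -- Two facts are carried along the chain: `M i` really pairs sheets of the same face to the right
  -- of vertex `i`, and every flag met so far shares its value with a sheet leaving there.
  have key : ∀ i (h : i + 1 < n),
      (∀ x, p ⟨i, by omega⟩ (true, M i x) = p ⟨i, by omega⟩ (true, x)) ∧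
      ∀ (j : Fin n) (z : Bool × Bool × ZMod 3), j.val ≤ i →
        ∃ x, p j z = p ⟨i, by omega⟩ (true, x) := by
    intro i
    induction i with
    | zero =>
      intro h
      have hL : ∀ x, p ⟨0, by omega⟩
          (false, loopPairing (c (⟨0, by omega⟩, false, false)) x) =
          p ⟨0, by omega⟩ (false, x) := by
        rintro ⟨b, j⟩
        have h1 := hslide ((⟨0, by omega⟩, false, b), j)
        change q (openChainOpp n (⟨0, by omega⟩, false, b), _ - j) = _ at h1
        have hb : c (⟨0, by omega⟩, false, b) = c (⟨0, by omega⟩, false, false) := by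
          cases b
          · rfl
          · rw [← hc, openChainOpp_first _ _ rfl]; rfl
        rw [openChainOpp_first _ _ rfl, hb] at h1
        exact h1
      refine ⟨hfirst.apply_right (hp _) hL, fun j z hj => ?_⟩
      have hj0 : j = ⟨0, by omega⟩ := Fin.ext (Nat.le_zero.1 hj)
      rw [hj0]
      exact hfirst.exists_right (hp _) hL z
    | succ i ih =>
      intro h
      obtain ⟨h1, h2⟩ := ih (by omega)
      have hL := hacross ⟨i, by omega⟩ (Nat.lt_of_succ_lt h) (M i) h1
      refine ⟨(hstep i h).apply_right (hp _) hL, fun j z hj => ?_⟩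
      rcases Nat.lt_or_ge i j.val with hij | hij
      · have hj1 : j = ⟨i + 1, by omega⟩ := Fin.ext (le_antisymm hj hij)
        rw [hj1]
        exact (hstep i h).exists_right (hp _) hL z
      · obtain ⟨⟨b, k⟩, hx⟩ := h2 j z hij
        obtain ⟨y, hy⟩ := (hstep i h).exists_right (hp _) hL
          (false, b, c (⟨i, by omega⟩, true, b) - k)
        exact ⟨y, by rw [hx, ← hy]; exact (hglue ⟨i, by omega⟩ (Nat.lt_of_succ_lt h) b k).symm⟩
  obtain ⟨h1, h2⟩ := key (n - 2) (by omega)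
  have hlt : n - 2 + 1 < n := by omega
  have hL := hacross ⟨n - 2, by omega⟩ hlt (M (n - 2)) h1
  have hv : (⟨n - 2 + 1, hlt⟩ : Fin n) = ⟨n - 1, by omega⟩ := Fin.ext (by simp; omega)
  have hR : ∀ x, p ⟨n - 2 + 1, hlt⟩
      (true, loopPairing (c (⟨n - 1, by omega⟩, true, false)) x) =
      p ⟨n - 2 + 1, hlt⟩ (true, x) := by
    rintro ⟨b, j⟩
    rw [hv]
    have hl : (⟨n - 1, by omega⟩ : Fin n).val + 1 = n := by simp; omega
    have h3 := hslide ((⟨n - 1, by omega⟩, true, b), j)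
    change q (openChainOpp n (⟨n - 1, by omega⟩, true, b), _ - j) = _ at h3
    have hb : c (⟨n - 1, by omega⟩, true, b) = c (⟨n - 1, by omega⟩, true, false) := by
      cases b
      · rfl
      · rw [← hc, openChainOpp_last _ _ hl]; rfl
    rw [openChainOpp_last _ _ hl, hb] at h3
    exact h3
  have hconst := hlast.apply_eq (hp ⟨n - 2 + 1, hlt⟩) hL hR
  have hall : ∀ (j : Fin n) z, p j z = p ⟨n - 2 + 1, hlt⟩ (false, false, 0) := by
    intro j z
    rcases Nat.lt_or_ge (n - 2) j.val with hj | hj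
    · obtain rfl : j = ⟨n - 2 + 1, hlt⟩ := Fin.ext (by simp; omega)
      exact hconst z
    · obtain ⟨⟨b, k⟩, hx⟩ := h2 j z hj
      rw [hx, ← hglue ⟨n - 2, by omega⟩ hlt b k, hconst]
  obtain ⟨⟨i, s, b⟩, k⟩ := x
  obtain ⟨⟨i', s', b'⟩, k'⟩ := y
  exact (hall i (s, b, k)).trans (hall i' (s', b', k')).symm

theorem chainPolyhedron_numFaces (hn : 2 ≤ n) (hc : ∀ h, c (openChainOpp n h) = c h)
    (M : ℕ → Bool × ZMod 3 → Bool × ZMod 3)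
    (hfirst : Transfers (loopPairing (c (⟨0, by omega⟩, false, false))) (M 0))
    (hstep : ∀ i (h : i + 2 < n),
      Transfers (acrossEdges (fun b => c (⟨i, by omega⟩, true, b)) (M i)) (M (i + 1)))
    (hlast : Closes (acrossEdges (fun b => c (⟨n - 2, by omega⟩, true, b)) (M (n - 2)))
      (loopPairing (c (⟨n - 1, by omega⟩, true, false)))) :
    (chainPolyhedron n c hc).numFaces = 1 := by
  refine Nat.card_eq_one_iff_unique.2 ⟨⟨fun x y => ?_⟩, ⟨Quot.mk _ ((⟨0, by omega⟩, true, true), 0)⟩⟩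
  induction x using Quot.ind with | mk x =>
  induction y using Quot.ind with | mk y =>
  -- The invariant is the face itself, so its constancy means that there is one face.
  refine flag_invariant_const hn hc (fun x => (Quot.mk _ x : (chainComplex n c hc).Face))
    (fun x => Eq.symm ?_) (fun x => Eq.symm ?_) M hfirst hstep hlast x y
  · exact Quot.sound (Or.inl rfl)
  · exact Quot.sound (Or.inr rfl)

end Faces

/-! ### Isomorphisms -/

/-- The other half-edge on the same side of a vertex of the open chain. -/
def chainTwin {n : ℕ} (h : Fin n × Bool × Bool) : Fin n × Bool × Bool := (h.1, h.2.1, !h.2.2)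

/-- The half-edge on the other side of a vertex of the open chain. -/
def chainFlip {n : ℕ} (h : Fin n × Bool × Bool) : Fin n × Bool × Bool := (h.1, !h.2.1, h.2.2)

theorem openChainOpp_chainTwin (n : ℕ) (h : Fin n × Bool × Bool) :
    openChainOpp n (chainTwin h) = chainTwin (openChainOpp n h) := by
  obtain ⟨i, s, b⟩ := h
  cases s
  · by_cases h0 : 0 < i.val <;> simp [openChainOpp, chainTwin, h0]
  · by_cases h0 : i.val + 1 < n <;> simp [openChainOpp, chainTwin, h0]

/-- A symmetry of the open chain: a permutation of the half-edges that respects edges and acts at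
each vertex through the Klein four-group. -/
structure IsChainSymm (n : ℕ) (g : Fin n × Bool × Bool ≃ Fin n × Bool × Bool) : Prop where
  opp : ∀ h, openChainOpp n (g h) = g (openChainOpp n h)
  twin : ∀ h, chainTwin (g h) = g (chainTwin h)
  flip : ∀ h, chainFlip (g h) = g (chainFlip h)

theorem IsChainSymm.symm {n : ℕ} {g : Fin n × Bool × Bool ≃ Fin n × Bool × Bool}
    (hg : IsChainSymm n g) : IsChainSymm n g.symm where
  opp h := by rw [Equiv.eq_symm_apply, ← hg.opp, Equiv.apply_symm_apply]
  twin h := by rw [Equiv.eq_symm_apply, ← hg.twin, Equiv.apply_symm_apply]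
  flip h := by rw [Equiv.eq_symm_apply, ← hg.flip, Equiv.apply_symm_apply]

theorem IsChainSymm.trans {n : ℕ} {g g' : Fin n × Bool × Bool ≃ Fin n × Bool × Bool}
    (hg : IsChainSymm n g) (hg' : IsChainSymm n g') : IsChainSymm n (g.trans g') where
  opp h := by simp only [Equiv.trans_apply, hg'.opp, hg.opp]
  twin h := by simp only [Equiv.trans_apply, hg'.twin, hg.twin]
  flip h := by simp only [Equiv.trans_apply, hg'.flip, hg.flip]

/-- The chain is connected: the three moves reach every half-edge from the first. -/
theorem chain_halfEdge_induction {n : ℕ} (hn : 0 < n) (p : Fin n × Bool × Bool → Prop)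
    (h0 : p (⟨0, hn⟩, false, false)) (hopp : ∀ h, p h → p (openChainOpp n h))
    (htwin : ∀ h, p h → p (chainTwin h)) (hflip : ∀ h, p h → p (chainFlip h))
    (h : Fin n × Bool × Bool) : p h := by
  have hall : ∀ i : Fin n, p (i, false, false) → ∀ a, p (i, a) := by
    rintro i hi ⟨s, b⟩
    cases s <;> cases b
    · exact hi
    · exact htwin _ hi
    · exact hflip _ hi
    · exact htwin _ (hflip _ hi)
  have key : ∀ i (hi : i < n), p (⟨i, hi⟩, false, false) := by
    intro i
    induction i with
    | zero => exact fun _ => h0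
    | succ i ih =>
      intro hi
      have h1 := hopp _ (hall ⟨i, by omega⟩ (ih (by omega)) (true, false))
      rwa [openChainOpp_right _ _ hi] at h1
  exact hall _ (key _ _) _

theorem IsChainSymm.ext {n : ℕ} (hn : 0 < n)
    {g g' : Fin n × Bool × Bool ≃ Fin n × Bool × Bool}
    (hg : IsChainSymm n g) (hg' : IsChainSymm n g')
    (h0 : g (⟨0, hn⟩, false, false) = g' (⟨0, hn⟩, false, false)) : g = g' := by
  refine Equiv.ext fun h => chain_halfEdge_induction hn (fun h => g h = g' h) h0 ?_ ?_ ?_ h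
  · intro h hh; rw [← hg.opp, ← hg'.opp, hh]
  · intro h hh; rw [← hg.twin, ← hg'.twin, hh]
  · intro h hh; rw [← hg.flip, ← hg'.flip, hh]

/-- The half-edges of the two closed edges of the open chain. -/
def chainLoops (n : ℕ) (hn : 0 < n) : Finset (Fin n × Bool × Bool) :=
  {(⟨0, hn⟩, false, false), (⟨0, hn⟩, false, true), (⟨n - 1, by omega⟩, true, false),
    (⟨n - 1, by omega⟩, true, true)}

theorem mem_chainLoops {n : ℕ} (hn : 0 < n) (h : Fin n × Bool × Bool)
    (hh : (openChainOpp n h).1 = h.1) : h ∈ chainLoops n hn := by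
  obtain ⟨⟨i, hi⟩, s, b⟩ := h
  cases s
  · by_cases h0 : 0 < i
    · simp only [openChainOpp, h0, if_true, Fin.mk.injEq] at hh
      omega
    · obtain rfl : i = 0 := by omega
      cases b <;> simp [chainLoops]
  · by_cases h0 : i + 1 < n
    · simp [openChainOpp, h0] at hh
    · obtain rfl : i = n - 1 := by omega
      cases b <;> simp [chainLoops]

/-- On closed edges the opposite is the twin; this lets an isomorphism recognise twins at the end of
the chain. -/
theorem openChainOpp_of_fst_eq {n : ℕ} (h : Fin n × Bool × Bool)
    (hh : (openChainOpp n h).1 = h.1) : openChainOpp n h = chainTwin h := by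
  obtain ⟨⟨i, hi⟩, s, b⟩ := h
  cases s
  · by_cases h0 : 0 < i
    · simp only [openChainOpp, h0, if_true, Fin.mk.injEq] at hh
      omega
    · simp [openChainOpp, h0, chainTwin]
  · by_cases h0 : i + 1 < n
    · simp [openChainOpp, h0] at hh
    · simp [openChainOpp, h0, chainTwin]

theorem card_chainLoops_le (n : ℕ) (hn : 0 < n) : (chainLoops n hn).card ≤ 4 :=
  Finset.card_le_four

/-- Two gluing parameters related by a symmetry of the open chain. -/
def chainSetoid (n : ℕ) : Setoid (Fin n × Bool × Bool → ZMod 3) where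
  r c c' := ∃ g, IsChainSymm n g ∧ ∀ h, c' (g h) = c h
  iseqv :=
    { refl := fun _ => ⟨Equiv.refl _, ⟨fun _ => rfl, fun _ => rfl, fun _ => rfl⟩, fun _ => rfl⟩
      symm := by
        rintro c c' ⟨g, hg, h⟩
        exact ⟨g.symm, hg.symm, fun x => by rw [← h, Equiv.apply_symm_apply]⟩
      trans := by
        rintro c c' c'' ⟨g, hg, h⟩ ⟨g', hg', h'⟩
        exact ⟨g.trans g', hg.trans hg', fun x => by rw [Equiv.trans_apply, h', h]⟩ }

/-- Each related `c'` is recovered from a symmetry, hence by `IsChainSymm.ext` from the image of the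
first half-edge, which is one of four loop half-edges. -/
theorem card_filter_chainSetoid_le {n : ℕ} (hn : 0 < n)
    (W : Finset (Fin n × Bool × Bool → ZMod 3)) (c : Fin n × Bool × Bool → ZMod 3)
    [DecidablePred fun c' => (chainSetoid n).r c c'] :
    (W.filter fun c' => (chainSetoid n).r c c').card ≤ 4 := by
  classical
  have hex : ∀ c' : Fin n × Bool × Bool → ZMod 3,
      ∃ g, (chainSetoid n).r c c' → IsChainSymm n g ∧ ∀ h, c' (g h) = c h := by
    intro c'
    by_cases h : (chainSetoid n).r c c'
    · obtain ⟨g, hg⟩ := h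
      exact ⟨g, fun _ => hg⟩
    · exact ⟨Equiv.refl _, fun h' => absurd h' h⟩
  choose G hG using hex
  refine le_trans (Finset.card_le_card_of_injOn (t := chainLoops n hn)
    (fun c' => G c' (⟨0, hn⟩, false, false)) ?_ ?_) (card_chainLoops_le n hn)
  · intro c' hc'
    obtain ⟨h1, -⟩ := hG c' (Finset.mem_filter.1 hc').2
    refine mem_chainLoops hn _ ?_
    rw [h1.opp, openChainOpp_first _ _ rfl]
    exact (congrArg Prod.fst (h1.twin (⟨0, hn⟩, false, false))).symm
  · intro c' hc' c'' hc'' h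
    obtain ⟨h1, h1'⟩ := hG c' (Finset.mem_filter.1 hc').2
    obtain ⟨h2, h2'⟩ := hG c'' (Finset.mem_filter.1 hc'').2
    have hgg := h1.ext hn h2 h
    funext x
    obtain ⟨y, rfl⟩ := (G c').surjective x
    rw [h1']
    rw [hgg, h2']

theorem linkSwap_add_of_twin : ∀ (s b : Bool) (t : ZMod 3),
    ((linkSwap (s, b, t)).1, (linkSwap (s, b, t)).2.1) = (s, !b) → t = 0 := by
  decide

/-- An isomorphism between two polyhedra along the open chain comes from a symmetry of the chain
that relates the gluing parameters. -/
theorem chainSetoid_of_isomorphic {n : ℕ} (hn : 0 < n) {c c' : Fin n × Bool × Bool → ZMod 3}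
    (hc : ∀ h, c (openChainOpp n h) = c h) (hc' : ∀ h, c' (openChainOpp n h) = c' h)
    (hiso : (chainPolyhedron n c hc).Isomorphic (chainPolyhedron n c' hc')) :
    (chainSetoid n).r c c' := by
  obtain ⟨f, g, k, horigin, hopp, hstrand, hswap, hslide, hrot⟩ := hiso
  change Fin n ≃ Fin n at f
  change Fin n × Bool × Bool ≃ Fin n × Bool × Bool at g
  change (Fin n × Bool × Bool) × ZMod 3 ≃ (Fin n × Bool × Bool) × ZMod 3 at k
  change ∀ h : Fin n × Bool × Bool, (g h).1 = f h.1 at horigin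
  change ∀ h : Fin n × Bool × Bool, openChainOpp n (g h) = g (openChainOpp n h) at hopp
  change ∀ x : (Fin n × Bool × Bool) × ZMod 3, (k x).1 = g x.1 at hstrand
  change ∀ x : (Fin n × Bool × Bool) × ZMod 3,
    (chainComplex n c' hc').swap (k x) = k ((chainComplex n c hc).swap x) at hswap
  change ∀ x : (Fin n × Bool × Bool) × ZMod 3,
    (openChainOpp n (k x).1, c' (k x).1 - (k x).2) =
      k (openChainOpp n x.1, c x.1 - x.2) at hslide
  change ∀ x : (Fin n × Bool × Bool) × ZMod 3, ((k x).1, (k x).2 + 1) = k (x.1, x.2 + 1) at hrot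
  -- Commuting with `rot`, the map `k` shifts the labels at `h` by a constant `t h`.
  let t : Fin n × Bool × Bool → ZMod 3 := fun h => (k (h, 0)).2
  have hk : ∀ h j, k (h, j) = (g h, t h + j) := by
    have h1 : ∀ h j, k (h, j + 1) = (g h, (k (h, j)).2 + 1) := fun h j => by
      rw [← hstrand (h, j)]
      exact (hrot (h, j)).symm
    have hk0 : ∀ h, k (h, 0) = (g h, t h) := fun h => Prod.ext (hstrand _) rfl
    have hk1 : ∀ h, k (h, 1) = (g h, t h + 1) := fun h => by
      have := h1 h 0
      rwa [zero_add, hk0] at this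
    have hk2 : ∀ h, k (h, 2) = (g h, t h + 2) := fun h => by
      have := h1 h 1
      rw [hk1, add_assoc, one_add_one_eq_two] at this
      exact this
    intro h j
    have hj : j = 0 ∨ j = 1 ∨ j = 2 := by revert j; decide
    obtain rfl | rfl | rfl := hj
    · rw [hk0, add_zero]
    · exact hk1 h
    · exact hk2 h
  have hloc : ∀ (i : Fin n) (s b : Bool) (j : ZMod 3),
      g (i, (linkSwap (s, b, j)).1, (linkSwap (s, b, j)).2.1) =
        ((g (i, s, b)).1, (linkSwap ((g (i, s, b)).2.1, (g (i, s, b)).2.2, t (i, s, b) + j)).1,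
          (linkSwap ((g (i, s, b)).2.1, (g (i, s, b)).2.2, t (i, s, b) + j)).2.1) ∧
      t (i, (linkSwap (s, b, j)).1, (linkSwap (s, b, j)).2.1) = t (i, s, b) := by
    intro i s b j
    have h1 := hswap ((i, s, b), j)
    rw [hk] at h1
    have h2 := h1.symm.trans rfl
    change k ((i, (linkSwap (s, b, j)).1, (linkSwap (s, b, j)).2.1), j) = _ at h2
    rw [hk] at h2
    exact ⟨congrArg Prod.fst h2, add_right_cancel (congrArg Prod.snd h2)⟩
  have htwin' : ∀ h, t (chainTwin h) = t h := by
    rintro ⟨i, s, b⟩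
    have := (hloc i s b 0).2
    simpa [linkSwap, chainTwin] using this
  have hflip' : ∀ h, t (chainFlip h) = t h := by
    rintro ⟨i, s, b⟩
    have := (hloc i s b 1).2
    simpa [linkSwap, chainFlip] using this
  -- Label 0 is the one joining twins, so the shift vanishes exactly where twins are preserved.
  have htwin_iff : ∀ h, g (chainTwin h) = chainTwin (g h) ↔ t h = 0 := by
    rintro ⟨i, s, b⟩
    have h1 := (hloc i s b 0).1
    have h2 : g (chainTwin (i, s, b)) = g (i, (linkSwap (s, b, 0)).1, (linkSwap (s, b, 0)).2.1) := by
      simp [linkSwap, chainTwin]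
    rw [h2, h1, add_zero]
    constructor
    · intro h
      exact linkSwap_add_of_twin _ _ _ (congrArg Prod.snd h)
    · intro h
      rw [h]
      simp [linkSwap, chainTwin]
  -- It vanishes at the first closed edge, whose image is closed. It spreads because `openChainOpp`
  -- commutes with `chainTwin`, and `t` is constant at each vertex.
  have ht : ∀ h, t h = 0 := by
    refine chain_halfEdge_induction hn _ ?_ ?_ ?_ ?_
    · have h1 := openChainOpp_first (⟨0, hn⟩ : Fin n) false rfl
      have h2 : (openChainOpp n (g (⟨0, hn⟩, false, false))).1 =
          (g (⟨0, hn⟩, false, false)).1 := by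
        rw [hopp, h1, horigin, horigin]
      rw [← htwin_iff, ← openChainOpp_of_fst_eq _ h2, hopp, h1]
      rfl
    · intro h hh
      rw [← htwin_iff] at hh ⊢
      rw [← openChainOpp_chainTwin, ← hopp, hh, openChainOpp_chainTwin, hopp]
    · intro h hh; rw [htwin', hh]
    · intro h hh; rw [hflip', hh]
  refine ⟨g, ⟨hopp, fun h => ((htwin_iff h).2 (ht h)).symm, ?_⟩, ?_⟩
  · rintro ⟨i, s, b⟩
    have h1 := (hloc i s b 1).1
    rw [ht, zero_add] at h1
    simpa [linkSwap, chainFlip] using h1.symm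
  · intro h
    have h1 := hslide (h, 0)
    simp only [hk, ht, add_zero, zero_add, sub_zero] at h1
    exact congrArg Prod.snd h1

/-! ### Counting -/

/-- Gluing parameters of the open chain with `m + 2` vertices from the parameters of the pairs of
edges (closed edges at the two ends) in their order along the chain. -/
def paramsOfWord {m : ℕ} (w : Fin (m + 3) → Bool → ZMod 3)
    (h : Fin (m + 2) × Bool × Bool) : ZMod 3 :=
  if h.2.1 then w h.1.succ h.2.2 else w h.1.castSucc h.2.2

theorem paramsOfWord_injective (m : ℕ) : Function.Injective (paramsOfWord (m := m)) := by
  intro w w' h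
  funext i b
  refine Fin.cases ?_ (fun i => ?_) i
  · exact congrFun h (0, false, b)
  · exact congrFun h (i, true, b)

theorem eq_of_mem_loopParams : ∀ u ∈ loopParams, ∀ b, u (!b) = u b := by decide

theorem paramsOfWord_opp {m : ℕ} (w : Fin (m + 3) → Bool → ZMod 3) (h0 : w 0 ∈ loopParams)
    (h1 : w (Fin.last _) ∈ loopParams) (h : Fin (m + 2) × Bool × Bool) :
    paramsOfWord w (openChainOpp (m + 2) h) = paramsOfWord w h := by
  obtain ⟨⟨i, hi⟩, s, b⟩ := h
  cases s
  · by_cases hi0 : 0 < i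
    · obtain ⟨i, rfl⟩ : ∃ j, i = j + 1 := ⟨i - 1, by omega⟩
      simp [openChainOpp, paramsOfWord]
    · obtain rfl : i = 0 := by omega
      exact eq_of_mem_loopParams _ h0 b
  · by_cases hi1 : i + 1 < m + 2
    · simp [openChainOpp, paramsOfWord, hi1]
    · obtain rfl : i = m + 1 := by omega
      rw [openChainOpp_last _ _ rfl]
      exact eq_of_mem_loopParams _ h1 b

/-- The parameters allowed at the position `i` of the chain with `m + 2` vertices if the initial
segments are to have the states `M`. -/
def wordParams (m : ℕ) (M : ℕ → Fin 3) (i : ℕ) : Finset (Bool → ZMod 3) :=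
  if i = 0 then loopParams
  else if i ≤ m then transferParams (M (i - 1)) (M i)
  else if i = m + 1 then closingParams (M m)
  else loopParams

/-- The factor is 24 = 2 · 6 · 2: first closed edge, closing pair, last closed edge. -/
theorem prod_card_wordParams (m : ℕ) (M : ℕ → Fin 3) (hM : M m ≠ 2) :
    ∏ i ∈ Finset.range (m + 3), (wordParams m M i).card =
      24 * ∏ i ∈ Finset.range m, (transferParams (M i) (M (i + 1))).card := by
  have h1 : ∏ i ∈ Finset.range m, (wordParams m M (i + 1)).card =
      ∏ i ∈ Finset.range m, (transferParams (M i) (M (i + 1))).card := by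
    refine Finset.prod_congr rfl fun i hi => ?_
    have : i + 1 ≤ m := Finset.mem_range.1 hi
    simp [wordParams, this]
  have h2 : wordParams m M 0 = loopParams := by simp [wordParams]
  have h3 : wordParams m M (m + 1) = closingParams (M m) := by simp [wordParams]
  have h4 : wordParams m M (m + 1 + 1) = loopParams := by simp [wordParams]
  rw [Finset.prod_range_succ, Finset.prod_range_succ, Finset.prod_range_succ', h1, h2, h3, h4,
    card_loopParams, card_closingParams _ hM]
  ring

theorem numFaces_of_word {m : ℕ} (M : ℕ → Fin 3) (hM0 : M 0 = 0)
    (w : Fin (m + 3) → Bool → ZMod 3) (hw : ∀ i : Fin (m + 3), w i ∈ wordParams m M i)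
    (hc : ∀ h, paramsOfWord w (openChainOpp (m + 2) h) = paramsOfWord w h) :
    (chainPolyhedron (m + 2) (paramsOfWord w) hc).numFaces = 1 := by
  refine chainPolyhedron_numFaces (by omega) hc (fun i => pairing (M i)) ?_ ?_ ?_
  · have h0 := hw 0
    simp only [wordParams, Fin.val_zero, if_true] at h0
    rw [hM0]
    exact transfers_loop _ h0
  · intro i hi
    have h1 := hw ⟨i + 1, by omega⟩
    have hi' : i + 1 ≤ m := by omega
    simp only [wordParams, Nat.succ_ne_zero, if_false, hi', if_true, Nat.add_sub_cancel] at h1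
    exact (Finset.mem_filter.1 h1).2
  · have h1 := hw ⟨m + 1, by omega⟩
    have h2 := hw ⟨m + 2, by omega⟩
    simp only [wordParams, Nat.succ_ne_zero, if_false, Nat.not_succ_le_self, if_true] at h1
    have h3 : ¬ m + 2 ≤ m := by omega
    simp only [wordParams, Nat.succ_ne_zero, if_false, h3, show m + 2 ≠ m + 1 by omega] at h2
    exact (Finset.mem_filter.1 h1).2 _ h2

/-- Sequences of states with many words of parameters. -/
theorem exists_states (m : ℕ) : ∃ M : ℕ → Fin 3, M 0 = 0 ∧ M m ≠ 2 ∧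
    2 / 3 * (12 : ℝ) ^ ((2 * (m : ℝ) - 1) / 3) ≤
      ((∏ i ∈ Finset.range m, (transferParams (M i) (M (i + 1))).card : ℕ) : ℝ) := by
  induction m using Nat.strong_induction_on with
  | _ m ih =>
    match m, ih with
    | 0, _ =>
      refine ⟨fun _ => 0, rfl, by decide, ?_⟩
      have : (12 : ℝ) ^ ((2 * ((0 : ℕ) : ℝ) - 1) / 3) ≤ 1 :=
        Real.rpow_le_one_of_one_le_of_nonpos (by norm_num) (by norm_num)
      simp only [Finset.range_zero, Finset.prod_empty, Nat.cast_one]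
      linarith
    | 1, _ =>
      refine ⟨fun i => if i = 0 then 0 else 1, rfl, by decide, ?_⟩
      have : (12 : ℝ) ^ ((2 * ((1 : ℕ) : ℝ) - 1) / 3) ≤ (12 : ℝ) ^ (1 / 2 : ℝ) :=
        Real.rpow_le_rpow_of_exponent_le (by norm_num) (by norm_num)
      -- The bound 9 is what (2/3) · 9 = 6 allows.
      have h2 : (12 : ℝ) ^ (1 / 2 : ℝ) ≤ 9 := by
        rw [← Real.sqrt_eq_rpow]
        exact Real.sqrt_le_iff.2 (by norm_num)
      simp only [Finset.prod_range_one, if_true, zero_add, one_ne_zero, if_false,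
        card_transferParams_zero_one]
      push_cast
      push_cast at this
      linarith
    | 2, _ =>
      -- The path 0 → 1 → 1 avoids ending in state 2, for which closing is not counted; it has 6 · 2
      -- choices.
      refine ⟨fun i => if i = 0 then 0 else 1, rfl, by decide, ?_⟩
      have : (12 : ℝ) ^ ((2 * ((2 : ℕ) : ℝ) - 1) / 3) = 12 := by
        rw [show ((2 * ((2 : ℕ) : ℝ) - 1) / 3) = 1 by norm_num, Real.rpow_one]
      rw [this]
      simp only [Finset.prod_range_succ, Finset.prod_range_zero, if_true, zero_add, one_ne_zero,
        if_false, card_transferParams_zero_one, card_transferParams_one_one, Nat.reduceAdd,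
        OfNat.ofNat_ne_zero]
      norm_num
    | m + 3, ih =>
      obtain ⟨M, h0, hm, hprod⟩ := ih m (by omega)
      have hlt : ∀ i ∈ Finset.range m,
          (transferParams (if i ≤ m then M i else M m + Fin.ofNat 3 (i - m))
            (if i + 1 ≤ m then M (i + 1) else M m + Fin.ofNat 3 (i + 1 - m))).card =
          (transferParams (M i) (M (i + 1))).card := by
        intro i hi
        have h1 : i + 1 ≤ m := Finset.mem_range.1 hi
        rw [if_pos h1, if_pos (by omega)]
      have h3 : M m + Fin.ofNat 3 3 = M m := by
        generalize M m = s; revert s; decide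
      -- One full cycle of states is appended: the final state is unchanged, and the count gains
      -- 144.
      refine ⟨fun i => if i ≤ m then M i else M m + Fin.ofNat 3 (i - m), by simpa using h0,
        ?_, ?_⟩
      · have e3 : m + 3 - m = 3 := by omega
        simp only [show ¬ m + 3 ≤ m by omega, if_false, e3, h3]
        exact hm
      · have e1 : m + 1 - m = 1 := by omega
        have e2 : m + 1 + 1 - m = 2 := by omega
        have e3 : m + 1 + 1 + 1 - m = 3 := by omega
        rw [Finset.prod_range_succ, Finset.prod_range_succ, Finset.prod_range_succ,
          Finset.prod_congr rfl hlt]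
        simp only [le_refl, if_true, show ¬ m + 1 ≤ m by omega, show ¬ m + 1 + 1 ≤ m by omega,
          show ¬ m + 1 + 1 + 1 ≤ m by omega, show m + 2 = m + 1 + 1 from rfl, if_false,
          e1, e2, e3, h3]
        have h4 := card_transferParams_succ (M m)
        have h5 : (12 : ℝ) ^ ((2 * ((m + 3 : ℕ) : ℝ) - 1) / 3) =
            (12 : ℝ) ^ ((2 * (m : ℝ) - 1) / 3) * 144 := by
          rw [show ((2 * ((m + 3 : ℕ) : ℝ) - 1) / 3) = (2 * (m : ℝ) - 1) / 3 + (2 : ℕ) by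
            push_cast; ring, Real.rpow_add (by norm_num), Real.rpow_natCast]
          norm_num
        rw [h5, mul_assoc, mul_assoc, ← mul_assoc (Finset.card _) (Finset.card _)]
        have h6 : (transferParams (M m) (M m + Fin.ofNat 3 1)).card *
            (transferParams (M m + Fin.ofNat 3 1) (M m + Fin.ofNat 3 2)).card *
            (transferParams (M m + Fin.ofNat 3 2) (M m)).card = 144 := h4
        rw [h6]
        push_cast at hprod ⊢
        nlinarith [hprod]

theorem proposition2p4 (n : ℕ) (hn : 2 ≤ n) :
    ∃ (N : ℕ) (P : Fin N → OrientedStandardPolyhedron),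
      4 * (12 : ℝ) ^ ((2 * (n : ℝ) - 5) / 3) ≤ (N : ℝ) ∧
      (∀ j, (P j).numFaces = 1 ∧ (P j).singularGraph.Isomorphic (openChain n)) ∧
      (∀ j k, j ≠ k → ¬ (P j).Isomorphic (P k)) := by
  classical
  obtain ⟨m, rfl⟩ : ∃ m, n = m + 2 := ⟨n - 2, by omega⟩
  obtain ⟨M, hM0, hMm, hbound⟩ := exists_states m
  let W : Finset (Fin (m + 2) × Bool × Bool → ZMod 3) :=
    (Fintype.piFinset fun i : Fin (m + 3) => wordParams m M i).image paramsOfWord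
  have hWcard : W.card =
      24 * ∏ i ∈ Finset.range m, (transferParams (M i) (M (i + 1))).card := by
    rw [Finset.card_image_of_injective _ (paramsOfWord_injective m), Fintype.card_piFinset,
      ← prod_card_wordParams m M hMm,
      Fin.prod_univ_eq_prod_range (fun i => (wordParams m M i).card)]
  have hW : ∀ c ∈ W, ∃ hc : ∀ h, c (openChainOpp (m + 2) h) = c h,
      (chainPolyhedron (m + 2) c hc).numFaces = 1 := by
    intro c hc
    obtain ⟨w, hw, rfl⟩ := Finset.mem_image.1 hc
    rw [Fintype.mem_piFinset] at hw
    have h0 : w 0 ∈ loopParams := by simpa [wordParams] using hw 0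
    have h1 : w (Fin.last _) ∈ loopParams := by simpa [wordParams] using hw (Fin.last _)
    exact ⟨paramsOfWord_opp w h0 h1, numFaces_of_word M hM0 w hw _⟩
  let π : (Fin (m + 2) × Bool × Bool → ZMod 3) → Quotient (chainSetoid (m + 2)) :=
    Quotient.mk _
  -- One representative per class is kept, at the cost of a factor 4.
  have hfiber : W.card ≤ 4 * (W.image π).card := by
    refine Finset.card_le_mul_card_image W 4 fun b hb => ?_
    obtain ⟨c, -, rfl⟩ := Finset.mem_image.1 hb
    refine le_trans (Finset.card_le_card fun c' hc' => ?_)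
      (card_filter_chainSetoid_le (by omega) W c)
    obtain ⟨h1, h2⟩ := Finset.mem_filter.1 hc'
    exact Finset.mem_filter.2 ⟨h1, Quotient.exact h2.symm⟩
  have hrep : ∀ j : Fin (W.image π).card, ∃ c ∈ W, π c = ((W.image π).equivFin.symm j).1 :=
    fun j => Finset.mem_image.1 ((W.image π).equivFin.symm j).2
  choose c hcW hcπ using hrep
  choose hc hface using fun j => hW (c j) (hcW j)
  refine ⟨(W.image π).card, fun j => chainPolyhedron (m + 2) (c j) (hc j), ?_,
    fun j => ⟨hface j, chainPolyhedron_singularGraph _ _ _⟩, fun j k hjk hiso => hjk ?_⟩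
  · have h1 : (W.card : ℝ) ≤ 4 * ((W.image π).card : ℝ) := by exact_mod_cast hfiber
    rw [hWcard, Nat.cast_mul] at h1
    have h2 : (2 * ((m + 2 : ℕ) : ℝ) - 5) / 3 = (2 * (m : ℝ) - 1) / 3 := by push_cast; ring
    rw [h2]
    push_cast at h1 hbound
    linarith
  · have h1 : π (c j) = π (c k) :=
      Quotient.sound (chainSetoid_of_isomorphic (by omega) (hc j) (hc k) hiso)
    rw [hcπ, hcπ] at h1
    exact (W.image π).equivFin.symm.injective (Subtype.ext h1)
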